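/- By a tree we mean a finite rooted planar binary tree; its leaves are numbered from left to right. Let \[ B_n=\left\langle s_1,\dots,s_{n-1}\;\middle|\; s_is_{i+1}s_i=s_{i+1}s_is_{i+1},\quad s_is_j=s_js_i \text{ for } |i-j|>1\right\rangle \] be the braid group on $n$ strands, where $\beta\gamma$ is $\beta$ stacked on top of $\gamma$, and let $\rho\colon B_n\to S_n$, $s_i\mapsto (i\;\,i{+}1)$, be the standard projection, so that the strand of $\beta$ numbered $k$ at the bottom is numbered $\rho(\beta)(k)$ at the top. Let $B_n\wr\mathbf Z=B_n\ltimes\mathbf Z^n$, with $B_n$ permuting the coordinates through $\rho$; its elements are written $\beta(m_1,\dots,m_n)$, and $(m_1,\dots,m_n)\beta=\beta(m_{\rho(\beta)(1)},\dots,m_{\rho(\beta)(n)})$. Consider triples $(T_-,\beta(m_1,\dots,m_n),T_+)$, where $n\ge 1$, $T_-$ and $T_+$ are trees with $n$ leaves and $\beta(m_1,\dots,m_n)\in B_n\wr\mathbf Z$. For $1\le k\le n$ the $k$th expansion of this triple is \[ \bigl(T_-',\;\beta' s_k^{m_k}(m_1,\dots,m_{k-1},m_k,m_k,m_{k+1},\dots,m_n),\;T_+'\bigr),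 \] where $T_+'$ is $T_+$ with a caret added to its $k$th leaf, $T_-'$ is $T_-$ with a caret added to its $\rho(\beta)(k)$th leaf, and $\beta'\in B_{n+1}$ is $\beta$ with its $k$th strand (counted at the bottom) bifurcated into two parallel strands. The ribbon braided Thompson group $rV$ is the set of classes $[T_-,\beta(m_1,\dots,m_n),T_+]$ of triples under the equivalence relation generated by expansion. Any two classes have representatives for which the right tree of the first equals the left tree of the second, and the group operation is given by \[ [T,g,U]\,[U,h,W]=[T,gh,W]. \] **Corollary.** The group $rV$ is perfect, that is, $rV=[rV,rV]$. -/

import Mathlib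

namespace RibbonThompson

/-! ### Braid groups -/

/-- The relators of the standard presentation of the braid group on `n` strands. The generators
`s_1, …, s_{n-1}` are indexed from `0`. -/
def braidRels (n : ℕ) : Set (FreeGroup (Fin (n - 1))) :=
  {w | ∃ i j : Fin (n - 1), (i : ℕ) + 1 = j ∧
    w = (FreeGroup.of i * FreeGroup.of j * FreeGroup.of i) *
      (FreeGroup.of j * FreeGroup.of i * FreeGroup.of j)⁻¹} ∪
  {w | ∃ i j : Fin (n - 1), (i : ℕ) + 1 < j ∧
    w = (FreeGroup.of i * FreeGroup.of j) * (FreeGroup.of j * FreeGroup.of i)⁻¹}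

/-- The braid group `B_n` on `n` strands. A product `β * γ` is read with `γ` at the bottom and
`β` stacked on top of it. -/
abbrev Braid (n : ℕ) : Type := PresentedGroup (braidRels n)

/-- The standard generator of `B_n` which crosses the strands at positions `i` and `i + 1`, where
positions are counted from `0` (and the junk value `1` when `i + 1` is not a position). -/
def s (n i : ℕ) : Braid n :=
  if h : i < n - 1 then PresentedGroup.of ⟨i, h⟩ else 1

theorem of_eq_s {n : ℕ} (i : Fin (n - 1)) : (PresentedGroup.of i : Braid n) = s n i := by
  simp [s]

theorem s_braid {n i : ℕ} (h : i + 2 < n) :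
    s n i * s n (i + 1) * s n i = s n (i + 1) * s n i * s n (i + 1) := by
  have h1 : i < n - 1 := by omega
  have h2 : i + 1 < n - 1 := by omega
  simp only [s, dif_pos h1, dif_pos h2]
  exact PresentedGroup.mk_eq_mk_of_mul_inv_mem (rels := braidRels n)
    (Or.inl ⟨⟨i, h1⟩, ⟨i + 1, h2⟩, rfl, rfl⟩)

theorem s_comm {n i j : ℕ} (h : i + 1 < j) : s n i * s n j = s n j * s n i := by
  by_cases h2 : j < n - 1
  · have h1 : i < n - 1 := by omega
    simp only [s, dif_pos h1, dif_pos h2]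
    exact PresentedGroup.mk_eq_mk_of_mul_inv_mem (rels := braidRels n)
      (Or.inr ⟨⟨i, h1⟩, ⟨j, h2⟩, h, rfl⟩)
  · simp [s, h2]

/-- A homomorphism out of the braid group from elements satisfying the braid relations. -/
def Braid.lift {n : ℕ} {G : Type*} [Group G] (f : Fin (n - 1) → G)
    (h1 : ∀ i j : Fin (n - 1), (i : ℕ) + 1 = j → f i * f j * f i = f j * f i * f j)
    (h2 : ∀ i j : Fin (n - 1), (i : ℕ) + 1 < j → f i * f j = f j * f i) : Braid n →* G :=
  PresentedGroup.toGroup (f := f) (rels := braidRels n) (by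
    rintro r (⟨i, j, hij, rfl⟩ | ⟨i, j, hij, rfl⟩)
    · simp only [map_mul, map_inv, FreeGroup.lift_apply_of]
      rw [h1 i j hij, mul_inv_cancel]
    · simp only [map_mul, map_inv, FreeGroup.lift_apply_of]
      rw [h2 i j hij, mul_inv_cancel])

theorem Braid.lift_of {n : ℕ} {G : Type*} [Group G] (f : Fin (n - 1) → G) (h1 h2)
    (i : Fin (n - 1)) : Braid.lift f h1 h2 (PresentedGroup.of i) = f i :=
  PresentedGroup.toGroup.of _

theorem Braid.induction {n : ℕ} {p : Braid n → Prop} (one : p 1)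
    (gen : ∀ i : Fin (n - 1), p (s n i)) (mul : ∀ x y, p x → p y → p (x * y))
    (inv : ∀ x, p x → p x⁻¹) (x : Braid n) : p x := by
  have hx : x ∈ Subgroup.closure (Set.range (PresentedGroup.of (rels := braidRels n))) := by
    rw [PresentedGroup.closure_range_of]; trivial
  induction hx using Subgroup.closure_induction with
  | mem x hx =>
    obtain ⟨i, rfl⟩ := hx
    rw [of_eq_s]; exact gen i
  | one => exact one
  | mul x y _ _ hx hy => exact mul x y hx hy
  | inv x _ hx => exact inv x hx

theorem perm_apply_inv {α : Type*} (σ : Equiv.Perm α) (a : α) : σ (σ⁻¹ a) = a := by simp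

theorem perm_inv_apply {α : Type*} (σ : Equiv.Perm α) (a : α) : σ⁻¹ (σ a) = a := by simp

/-! ### The projection to the symmetric group -/

/-- The transposition of the positions `i` and `i + 1`. -/
def adj (n : ℕ) (i : Fin (n - 1)) : Equiv.Perm (Fin n) :=
  Equiv.swap ⟨i, by omega⟩ ⟨i + 1, by omega⟩

/-- The underlying function of `adj` on natural numbers. -/
def adjFun (i k : ℕ) : ℕ := if k = i then i + 1 else if k = i + 1 then i else k

theorem adj_val {n : ℕ} (i : Fin (n - 1)) (k : Fin n) : (adj n i k : ℕ) = adjFun i k := by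
  simp only [adj, adjFun, Equiv.swap_apply_def, Fin.ext_iff]
  split_ifs <;> rfl

theorem adjFun_self {i : ℕ} : adjFun i i = i + 1 := by simp [adjFun]

theorem adjFun_succ {i : ℕ} : adjFun i (i + 1) = i := by simp [adjFun]

theorem adjFun_of_ne {i k : ℕ} (h1 : k ≠ i) (h2 : k ≠ i + 1) : adjFun i k = k := by
  simp [adjFun, h1, h2]

theorem adjFun_braid (i k : ℕ) :
    adjFun i (adjFun (i + 1) (adjFun i k)) = adjFun (i + 1) (adjFun i (adjFun (i + 1) k)) := by
  have h0 : adjFun (i + 1) i = i := adjFun_of_ne (by omega) (by omega)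
  have h2 : adjFun i (i + 1 + 1) = i + 1 + 1 := adjFun_of_ne (by omega) (by omega)
  by_cases h : k = i
  · rw [h, adjFun_self, adjFun_self, h2, h0, adjFun_self, adjFun_self]
  by_cases h' : k = i + 1
  · rw [h', adjFun_succ, h0, adjFun_self, adjFun_self, h2, adjFun_succ]
  by_cases h'' : k = i + 1 + 1
  · rw [h'', h2, adjFun_succ, adjFun_succ, h0]
  · rw [adjFun_of_ne h h', adjFun_of_ne h' h'', adjFun_of_ne h h', adjFun_of_ne h' h'']

theorem adj_braid {n : ℕ} (i j : Fin (n - 1)) (h : (i : ℕ) + 1 = j) :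
    adj n i * adj n j * adj n i = adj n j * adj n i * adj n j := by
  ext k
  simp only [Equiv.Perm.mul_apply, adj_val, ← h, adjFun_braid]

theorem adj_comm {n : ℕ} (i j : Fin (n - 1)) (h : (i : ℕ) + 1 < j) :
    adj n i * adj n j = adj n j * adj n i := by
  ext k
  simp only [Equiv.Perm.mul_apply, adj_val, adjFun]
  split_ifs <;> omega

/-- The projection `ρ_n : B_n → S_n`: the strand of `β` which is at position `k` at the bottom is
at position `ρ β k` at the top. -/
def ρ (n : ℕ) : Braid n →* Equiv.Perm (Fin n) := Braid.lift (adj n) adj_braid adj_comm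

theorem ρ_s {n : ℕ} (i : Fin (n - 1)) : ρ n (s n i) = adj n i := by
  rw [← of_eq_s]; exact Braid.lift_of _ _ _ _

/-! ### Wreath products -/

/-- The permutational wreath product `G ⋉ Aⁿ`, with the acting group on the left, where `G` acts
on the coordinates through `σ : G → S_n`. The element `⟨g, m⟩` stands for `g (m_1, …, m_n)`. -/
@[ext]
structure Wreath {G : Type*} [Group G] {n : ℕ} (σ : G →* Equiv.Perm (Fin n)) (A : Type*) where
  top : G
  base : Fin n → A

namespace Wreath

variable {G : Type*} [Group G] {n : ℕ} {σ : G →* Equiv.Perm (Fin n)} {A : Type*} [Group A]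

/-- The product is determined by
`(m_1, …, m_n) g = g (m_{σ(g)(1)}, …, m_{σ(g)(n)})`. -/
instance : Mul (Wreath σ A) := ⟨fun x y => ⟨x.top * y.top, fun i => x.base (σ y.top i) * y.base i⟩⟩

instance : One (Wreath σ A) := ⟨⟨1, 1⟩⟩

instance : Inv (Wreath σ A) := ⟨fun x => ⟨x.top⁻¹, fun i => (x.base ((σ x.top)⁻¹ i))⁻¹⟩⟩

@[simp] theorem mul_top (x y : Wreath σ A) : (x * y).top = x.top * y.top := rfl
@[simp] theorem mul_base (x y : Wreath σ A) (i : Fin n) :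
    (x * y).base i = x.base (σ y.top i) * y.base i := rfl
@[simp] theorem one_top : (1 : Wreath σ A).top = 1 := rfl
@[simp] theorem one_base (i : Fin n) : (1 : Wreath σ A).base i = 1 := rfl
@[simp] theorem inv_top (x : Wreath σ A) : x⁻¹.top = x.top⁻¹ := rfl
@[simp] theorem inv_base (x : Wreath σ A) (i : Fin n) :
    x⁻¹.base i = (x.base ((σ x.top)⁻¹ i))⁻¹ := rfl

instance : Group (Wreath σ A) :=
  Group.ofLeftAxioms
    (fun x y z => by ext <;> simp [mul_assoc])
    (fun x => by ext <;> simp)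
    (fun x => by ext <;> simp)

/-- The projection of a wreath product onto the acting group. -/
def topHom : Wreath σ A →* G where
  toFun := top
  map_one' := rfl
  map_mul' _ _ := rfl

end Wreath

/-! ### Bifurcating a strand of a braid -/

/-- The braid on `n + 1` strands obtained from the generator `s n i` by bifurcating the strand
which is at position `k` at the bottom into two parallel strands. -/
def cableGen (n i k : ℕ) : Braid (n + 1) :=
  if k < i then s (n + 1) (i + 1)
  else if k = i then s (n + 1) i * s (n + 1) (i + 1)
  else if k = i + 1 then s (n + 1) (i + 1) * s (n + 1) i
  else s (n + 1) i

theorem cableGen_lt {n i k : ℕ} (h : k < i) : cableGen n i k = s (n + 1) (i + 1) := by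
  simp [cableGen, h]

theorem cableGen_self {n i : ℕ} : cableGen n i i = s (n + 1) i * s (n + 1) (i + 1) := by
  simp [cableGen]

theorem cableGen_succ {n i : ℕ} : cableGen n i (i + 1) = s (n + 1) (i + 1) * s (n + 1) i := by
  simp [cableGen]

theorem cableGen_gt {n i k : ℕ} (h : i + 1 < k) : cableGen n i k = s (n + 1) i := by
  rw [cableGen, if_neg (by omega), if_neg (by omega), if_neg (by omega)]

theorem cableGen_braid {n i : ℕ} (h : i + 2 < n) (k : ℕ) :
    cableGen n i (adjFun (i + 1) (adjFun i k)) * cableGen n (i + 1) (adjFun i k) * cableGen n i k =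
    cableGen n (i + 1) (adjFun i (adjFun (i + 1) k)) * cableGen n i (adjFun (i + 1) k) *
      cableGen n (i + 1) k := by
  have e1 := s_braid (n := n + 1) (i := i) (by omega)
  have e2 := s_braid (n := n + 1) (i := i + 1) (by omega)
  have e3 := s_comm (n := n + 1) (i := i) (j := i + 2) (by omega)
  simp only [show i + 1 + 1 = i + 2 from rfl] at e2
  rcases lt_or_ge k i with hk | hk
  · rw [adjFun_of_ne (i := i) (k := k) (by omega) (by omega),
      adjFun_of_ne (i := i + 1) (k := k) (by omega) (by omega),
      adjFun_of_ne (i := i) (k := k) (by omega) (by omega), cableGen_lt hk, cableGen_lt (by omega)]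
    exact e2
  obtain rfl | hk := hk.eq_or_lt'
  · rw [adjFun_self, adjFun_self, adjFun_of_ne (i := k + 1) (k := k) (by omega) (by omega),
      adjFun_self, cableGen_gt (by omega), cableGen_self, cableGen_self, cableGen_lt (by omega)]
    simp only [show k + 1 + 1 = k + 2 from rfl]
    generalize s (n + 1) k = a at *
    generalize s (n + 1) (k + 1) = b at *
    generalize s (n + 1) (k + 2) = c at *
    calc a * (b * c) * (a * b) = a * b * (c * a) * b := by group
      _ = (a * b * a) * (c * b) := by rw [← e3]; group
      _ = b * a * (b * c * b) := by rw [e1]; group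
      _ = b * (a * c) * (b * c) := by rw [e2]; group
      _ = _ := by rw [e3]; group
  obtain rfl | hk := (Nat.succ_le_of_lt hk).eq_or_lt'
  · simp only [Nat.succ_eq_add_one] at *
    rw [adjFun_succ, adjFun_of_ne (i := i + 1) (k := i) (by omega) (by omega), adjFun_self,
      adjFun_of_ne (i := i) (k := i + 1 + 1) (by omega) (by omega),
      cableGen_self, cableGen_self, cableGen_lt (by omega), cableGen_succ, cableGen_succ, cableGen_gt (by omega)]
    simp only [show i + 1 + 1 = i + 2 from rfl]
    generalize s (n + 1) i = a at *
    generalize s (n + 1) (i + 1) = b at *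
    generalize s (n + 1) (i + 2) = c at *
    calc a * b * c * (b * a) = a * (b * c * b) * a := by group
      _ = (a * c) * b * (c * a) := by rw [e2]; group
      _ = c * a * b * (a * c) := by rw [e3]
      _ = c * (a * b * a) * c := by group
      _ = _ := by rw [e1]; group
  obtain rfl | hk := (Nat.succ_le_of_lt hk).eq_or_lt'
  · simp only [Nat.succ_eq_add_one] at *
    rw [adjFun_of_ne (i := i) (k := i + 1 + 1) (by omega) (by omega), adjFun_succ, adjFun_succ,
      cableGen_succ, cableGen_succ, cableGen_lt (i := i + 1) (k := i) (by omega),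
      cableGen_gt (i := i) (k := i + 1 + 1) (by omega)]
    simp only [show i + 1 + 1 = i + 2 from rfl]
    generalize s (n + 1) i = a at *
    generalize s (n + 1) (i + 1) = b at *
    generalize s (n + 1) (i + 2) = c at *
    calc b * a * (c * b) * a = b * (a * c) * b * a := by group
      _ = (b * c) * (a * b * a) := by rw [e3]; group
      _ = (b * c * b) * a * b := by rw [e1]; group
      _ = c * b * (c * a) * b := by rw [e2]; group
      _ = _ := by rw [← e3]; group
  · simp only [Nat.succ_eq_add_one] at *
    rw [adjFun_of_ne (i := i) (k := k) (by omega) (by omega),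
      adjFun_of_ne (i := i + 1) (k := k) (by omega) (by omega),
      adjFun_of_ne (i := i) (k := k) (by omega) (by omega), cableGen_gt (by omega),
      cableGen_gt (by omega)]
    exact e1

theorem cableGen_comm {n i j : ℕ} (h : i + 1 < j) (k : ℕ) :
    cableGen n i (adjFun j k) * cableGen n j k = cableGen n j (adjFun i k) * cableGen n i k := by
  have c1 := s_comm (n := n + 1) (i := i) (j := j) (by omega)
  have c2 := s_comm (n := n + 1) (i := i + 1) (j := j + 1) (by omega)
  have c3 := s_comm (n := n + 1) (i := i) (j := j + 1) (by omega)
  generalize ha : s (n + 1) i = a at *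
  generalize hb : s (n + 1) (i + 1) = b at *
  generalize hc : s (n + 1) j = c at *
  generalize hd : s (n + 1) (j + 1) = d at *
  by_cases hk : k < j
  · rw [adjFun_of_ne (i := j) (k := k) (by omega) (by omega), cableGen_lt hk,
      cableGen_lt (k := adjFun i k) (by simp only [adjFun]; split_ifs <;> omega)]
    simp only [cableGen, ha, hb, hd]
    split_ifs
    · exact c2
    · rw [mul_assoc, c2, ← mul_assoc, c3, mul_assoc]
    · rw [mul_assoc, c3, ← mul_assoc, c2, mul_assoc]
    · exact c3
  · rw [adjFun_of_ne (i := i) (k := k) (by omega) (by omega),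
      cableGen_gt (i := i) (k := k) (by omega),
      cableGen_gt (i := i) (k := adjFun j k) (by simp only [adjFun]; split_ifs <;> omega), ha]
    simp only [cableGen, hc, hd]
    split_ifs
    · rw [← mul_assoc, c1, mul_assoc, c3, mul_assoc]
    · rw [← mul_assoc, c3, mul_assoc, c1, mul_assoc]
    · exact c1

/-- The homomorphism which records, for a braid `β ∈ B_n`, its permutation together with all the
braids obtained from it by bifurcating one strand. -/
def cableHom (n : ℕ) :
    Braid n →* Wreath (MonoidHom.id (Equiv.Perm (Fin n))) (Braid (n + 1)) :=
  Braid.lift (fun i => ⟨adj n i, fun k => cableGen n i k⟩)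
    (fun i j h => by
      ext k
      · simp [adj_braid i j h]
      · have := cableGen_braid (n := n) (i := i) (by omega) k
        simpa [adj_val, ← h] using this)
    (fun i j h => by
      ext k
      · simp [adj_comm i j h]
      · simpa [adj_val] using cableGen_comm (n := n) h k)

/-- The braid obtained from `β` by bifurcating its `k`-th strand, counted at the bottom, into two
parallel strands. It is determined by its values on the generators and by
`cable (β * γ) k = cable β (ρ γ k) * cable γ k`. -/
def cable {n : ℕ} (β : Braid n) (k : Fin n) : Braid (n + 1) := (cableHom n β).base k

theorem cableHom_top {n : ℕ} (β : Braid n) : (cableHom n β).top = ρ n β := by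
  have : (Wreath.topHom).comp (cableHom n) = ρ n := by
    apply PresentedGroup.ext
    intro i
    simp only [MonoidHom.comp_apply, cableHom, Braid.lift_of, ρ]
    rfl
  exact DFunLike.congr_fun this β

theorem cable_one {n : ℕ} (k : Fin n) : cable 1 k = 1 := by
  simp [cable]

theorem cable_s {n : ℕ} (i : Fin (n - 1)) (k : Fin n) : cable (s n i) k = cableGen n i k := by
  rw [← of_eq_s, cable, cableHom, Braid.lift_of]

theorem cable_mul {n : ℕ} (β γ : Braid n) (k : Fin n) :
    cable (β * γ) k = cable β (ρ n γ k) * cable γ k := by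
  simp [cable, cableHom_top]

theorem cable_inv {n : ℕ} (β : Braid n) (k : Fin n) :
    cable β⁻¹ k = (cable β ((ρ n β)⁻¹ k))⁻¹ := by
  simp [cable, cableHom_top]

theorem predAbove_val {n : ℕ} (p : Fin n) (i : Fin (n + 1)) :
    (p.predAbove i : ℕ) = if (i : ℕ) ≤ p then (i : ℕ) else i - 1 := by
  simp only [Fin.predAbove, Fin.lt_def, Fin.val_castSucc]
  split_ifs <;> first | omega | simp

theorem predAbove_ρ_cable {n : ℕ} (β : Braid n) : ∀ (k : Fin n) (i : Fin (n + 1)),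
    (ρ n β k).predAbove (ρ (n + 1) (cable β k) i) = ρ n β (k.predAbove i) := by
  induction β using Braid.induction with
  | one => intro k i; simp [cable_one]
  | gen j =>
    intro k i
    have e1 := ρ_s (n := n + 1) ⟨j, by omega⟩
    have e2 := ρ_s (n := n + 1) ⟨j + 1, by omega⟩
    simp only at e1 e2
    rw [cable_s, ρ_s]
    apply Fin.ext
    simp only [cableGen]
    split_ifs <;>
    · simp only [map_mul, e1, e2, Equiv.Perm.mul_apply, predAbove_val, adj_val, adjFun]
      split_ifs <;> omega
  | mul x y hx hy => intro k i; simp [cable_mul, hx, hy]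
  | inv x hx =>
    intro k i
    have := hx ((ρ n x)⁻¹ k) ((ρ (n + 1) (cable x ((ρ n x)⁻¹ k)))⁻¹ i)
    rw [perm_apply_inv, perm_apply_inv] at this
    rw [cable_inv, map_inv, map_inv, this, perm_inv_apply]

theorem s_mul_cable {n : ℕ} (β : Braid n) : ∀ k : Fin n,
    s (n + 1) (ρ n β k) * cable β k = cable β k * s (n + 1) k := by
  induction β using Braid.induction with
  | one => intro k; simp [cable_one]
  | gen j =>
    intro k
    rw [cable_s, ρ_s, adj_val]
    have hb := s_braid (n := n + 1) (i := j) (by omega)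
    rcases lt_trichotomy (k : ℕ) j with hk | hk | hk
    · rw [cableGen_lt hk, adjFun_of_ne (i := j) (k := k) (by omega) (by omega)]
      exact s_comm (by omega)
    · rw [hk, cableGen_self, adjFun_self, ← mul_assoc, hb]
    · obtain hk | hk := (Nat.succ_le_of_lt hk).eq_or_lt
      · simp only [Nat.succ_eq_add_one] at hk
        rw [← hk, cableGen_succ, adjFun_succ, ← mul_assoc, hb]
      · simp only [Nat.succ_eq_add_one] at hk
        rw [cableGen_gt (by omega), adjFun_of_ne (i := j) (k := k) (by omega) (by omega)]
        exact (s_comm (by omega)).symm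
  | mul x y hx hy =>
    intro k
    rw [cable_mul, map_mul, Equiv.Perm.mul_apply, ← mul_assoc, hx, mul_assoc, hy, mul_assoc]
  | inv x hx =>
    intro k
    have := hx ((ρ n x)⁻¹ k)
    rw [perm_apply_inv] at this
    rw [cable_inv, map_inv, mul_inv_eq_iff_eq_mul, mul_assoc, this, inv_mul_cancel_left]

theorem cable_s' {n i : ℕ} (h : i < n - 1) (k : Fin n) : cable (s n i) k = cableGen n i k :=
  cable_s ⟨i, h⟩ k

theorem ρ_s_val {n i : ℕ} (h : i < n - 1) (k : Fin n) : (ρ n (s n i) k : ℕ) = adjFun i k := by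
  rw [← adj_val ⟨i, h⟩ k, ← ρ_s]

theorem predAbove_castSucc_of_lt {n : ℕ} {k l : Fin n} (h : k < l) :
    l.predAbove k.castSucc = k := by
  have h' : (k : ℕ) < l := h
  apply Fin.ext
  rw [predAbove_val, Fin.val_castSucc, if_pos h'.le]

theorem predAbove_succ_of_lt {n : ℕ} {k l : Fin n} (h : k < l) : k.predAbove l.succ = l := by
  have h' : (k : ℕ) < l := h
  apply Fin.ext
  rw [predAbove_val, Fin.val_succ, if_neg (by omega), Nat.add_sub_cancel]

theorem cable_cable_mul {n : ℕ} (x y : Braid n)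
    (hx : ∀ k l : Fin n, k < l →
      cable (cable x l) k.castSucc = cable (cable x k) l.succ) (k l : Fin n) (hkl : k < l) :
    ∃ A, cable (cable (x * y) l) k.castSucc = A * cable (cable y l) k.castSucc ∧
      cable (cable (x * y) k) l.succ = A * cable (cable y k) l.succ := by
  have hne : ρ n y k ≠ ρ n y l := fun h => hkl.ne ((ρ n y).injective h)
  have e1 := congrArg Fin.val (predAbove_ρ_cable y l k.castSucc)
  have e2 := congrArg Fin.val (predAbove_ρ_cable y k l.succ)
  rw [predAbove_castSucc_of_lt hkl, predAbove_val] at e1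
  rw [predAbove_succ_of_lt hkl, predAbove_val] at e2
  rw [cable_mul, cable_mul, cable_mul, cable_mul]
  rcases lt_or_gt_of_ne hne with h | h
  · have f1 : ρ (n + 1) (cable y l) k.castSucc = (ρ n y k).castSucc := by
      apply Fin.ext; rw [Fin.val_castSucc]; split_ifs at e1 <;> omega
    have f2 : ρ (n + 1) (cable y k) l.succ = (ρ n y l).succ := by
      apply Fin.ext; rw [Fin.val_succ]; split_ifs at e2 <;> omega
    exact ⟨_, by rw [f1], by rw [f2, hx _ _ h]⟩
  · have f1 : ρ (n + 1) (cable y l) k.castSucc = (ρ n y k).succ := by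
      apply Fin.ext; rw [Fin.val_succ]; split_ifs at e1 <;> omega
    have f2 : ρ (n + 1) (cable y k) l.succ = (ρ n y l).castSucc := by
      apply Fin.ext; rw [Fin.val_castSucc]; split_ifs at e2 <;> omega
    exact ⟨_, by rw [f1], by rw [f2, hx _ _ h]⟩

/-- Bifurcating two different strands can be done in either order. -/
theorem cable_cable {n : ℕ} (β : Braid n) : ∀ k l : Fin n, k < l →
    cable (cable β l) k.castSucc = cable (cable β k) l.succ := by
  induction β using Braid.induction with
  | one => intro k l _; simp [cable_one]
  | gen j =>
    intro k l hkl
    have hkl' : (k : ℕ) < l := hkl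
    have hj : (j : ℕ) < n + 1 - 1 := by omega
    have hj' : (j : ℕ) + 1 < n + 1 - 1 := by omega
    have e := s_comm (n := n + 1 + 1) (i := j) (j := j + 1 + 1) (by omega)
    rw [cable_s, cable_s]
    generalize hk : (k : ℕ) = k' at *
    generalize hl : (l : ℕ) = l' at *
    by_cases h : k' = j ∧ l' = j + 1
    · obtain ⟨rfl, rfl⟩ := h
      rw [cableGen_self, cableGen_succ, cable_mul, cable_mul, cable_s' hj, cable_s' hj',
        cable_s' hj, cable_s' hj', ρ_s_val hj, ρ_s_val hj', Fin.val_succ, Fin.val_castSucc, hk, hl,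
        adjFun_self, adjFun_succ, cableGen_self, cableGen_self, cableGen_succ, cableGen_succ,
        mul_assoc, ← mul_assoc (s _ (_ + 1 + 1)), ← e]
      simp only [mul_assoc]
    · have h1 := @cableGen_lt n
      simp only [cableGen]
      split_ifs <;> first
        | omega
        | (simp only [cable_mul, cable_s' hj, cable_s' hj', ρ_s_val hj, ρ_s_val hj', Fin.val_succ,
            Fin.val_castSucc, hk, hl, cableGen, adjFun]
           split_ifs <;> first | rfl | omega)
  | mul x y hx hy =>
    intro k l hkl
    obtain ⟨A, h1, h2⟩ := cable_cable_mul x y hx k l hkl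
    rw [h1, h2, hy k l hkl]
  | inv x hx =>
    intro k l hkl
    obtain ⟨A, h1, h2⟩ := cable_cable_mul x x⁻¹ hx k l hkl
    simp only [mul_inv_cancel, cable_one] at h1 h2
    exact mul_left_cancel (h1.symm.trans h2)

/-! ### Ribbon braids -/

/-- The group `B_n ≀ ℤ = B_n ⋉ ℤⁿ` of ribbon braids: the element `β(m_1, …, m_n)` is a braid `β`
of ribbons in which the ribbon at position `i` at the bottom has been given `m_i` half twists. -/
abbrev RibbonBraid (n : ℕ) : Type := Wreath (ρ n) (Multiplicative ℤ)

namespace RibbonBraid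

/-- The ribbon braid `β(m_1, …, m_n)`. -/
def mk {n : ℕ} (β : Braid n) (m : Fin n → ℤ) : RibbonBraid n :=
  ⟨β, fun i => Multiplicative.ofAdd (m i)⟩

/-- The permutation underlying a ribbon braid. -/
def perm {n : ℕ} (g : RibbonBraid n) : Equiv.Perm (Fin n) := ρ n g.top

/-- The number of half twists of the ribbon at position `i` at the bottom. -/
def twist {n : ℕ} (g : RibbonBraid n) (i : Fin n) : ℤ := Multiplicative.toAdd (g.base i)

/-- The ribbon braid
`β' s_k^{m_k} (m_1, …, m_{k-1}, m_k, m_k, m_{k+1}, …, m_n)` obtained from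
`β(m_1, …, m_n)` by bifurcating the `k`-th ribbon, where `β'` is `β` with its `k`-th strand
bifurcated. The map `k.predAbove : Fin (n + 1) → Fin n` is the monotone surjection which takes the
value `k` at the two positions `k` and `k + 1`. -/
def split {n : ℕ} (g : RibbonBraid n) (k : Fin n) : RibbonBraid (n + 1) :=
  mk (cable g.top k * s (n + 1) k ^ g.twist k) (fun i => g.twist (k.predAbove i))

theorem ρ_s_zpow {n : ℕ} (k : Fin n) (i : Fin (n + 1)) (z : ℤ) :
    k.predAbove (ρ (n + 1) (s (n + 1) k ^ z) i) = k.predAbove i := by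
  have base : ∀ i, k.predAbove (ρ (n + 1) (s (n + 1) k) i) = k.predAbove i := by
    intro i
    apply Fin.ext
    rw [predAbove_val, predAbove_val, ρ_s_val (by omega), adjFun]
    split_ifs <;> omega
  induction z generalizing i with
  | zero => simp
  | succ z hz => rw [zpow_add_one, map_mul, Equiv.Perm.mul_apply, hz, base]
  | pred z hz =>
    rw [zpow_sub_one, map_mul, Equiv.Perm.mul_apply, hz, ← base, map_inv, perm_apply_inv]

theorem ρ_s_zpow_of_ne {n : ℕ} (k : Fin n) (z : ℤ) (i : Fin (n + 1)) (h1 : (i : ℕ) ≠ k)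
    (h2 : (i : ℕ) ≠ k + 1) : ρ (n + 1) (s (n + 1) k ^ z) i = i := by
  have h := congrArg Fin.val (ρ_s_zpow k i z)
  rw [predAbove_val, predAbove_val] at h
  apply Fin.ext
  split_ifs at h <;> omega

theorem cable_s_zpow {n : ℕ} (k : Fin n) (z : ℤ) (i : Fin (n + 1)) (j : ℕ)
    (h : (i : ℕ) < k ∧ j = k + 1 ∨ (k : ℕ) + 1 < i ∧ j = k) :
    cable (s (n + 1) k ^ z) i = s (n + 2) j ^ z := by
  have hk : (k : ℕ) < n + 1 - 1 := by omega
  have hρ : ρ (n + 1) (s (n + 1) k) i = i := by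
    apply Fin.ext
    rw [ρ_s_val hk, adjFun_of_ne] <;> omega
  have hc : cable (s (n + 1) k) i = s (n + 2) j := by
    rw [cable_s' hk]
    rcases h with ⟨h, rfl⟩ | ⟨h, rfl⟩
    · exact cableGen_lt h
    · exact cableGen_gt h
  have hρ' : (ρ (n + 1) (s (n + 1) k))⁻¹ i = i := by
    rw [Equiv.Perm.inv_eq_iff_eq, hρ]
  induction z with
  | zero => simp [cable_one]
  | succ z hz => rw [zpow_add_one, cable_mul, hρ, hz, hc, zpow_add_one]
  | pred z hz => rw [zpow_sub_one, cable_mul, cable_inv, map_inv, hρ', hz, hc, zpow_sub_one]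

theorem s_zpow_mul_cable {n : ℕ} (β : Braid n) (k : Fin n) (z : ℤ) :
    s (n + 1) (ρ n β k) ^ z * cable β k = cable β k * s (n + 1) k ^ z := by
  have h : SemiconjBy (cable β k) (s (n + 1) k) (s (n + 1) (ρ n β k)) := (s_mul_cable β k).symm
  exact (h.zpow_right z).symm

theorem predAbove_perm_split {n : ℕ} (g : RibbonBraid n) (k : Fin n) (i : Fin (n + 1)) :
    (g.perm k).predAbove ((g.split k).perm i) = g.perm (k.predAbove i) := by
  simp only [perm, split, mk, map_mul, Equiv.Perm.mul_apply]
  rw [predAbove_ρ_cable, ρ_s_zpow]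

theorem split_one {n : ℕ} (k : Fin n) : (1 : RibbonBraid n).split k = 1 := by
  ext <;> simp [split, mk, cable_one, twist]

theorem split_mul {n : ℕ} (g h : RibbonBraid n) (k : Fin n) :
    (g * h).split k = g.split (h.perm k) * h.split k := by
  apply Wreath.ext
  · simp only [split, mk, Wreath.mul_top, twist, Wreath.mul_base, toAdd_mul, cable_mul, zpow_add,
      perm]
    have := s_zpow_mul_cable h.top k (Multiplicative.toAdd (g.base (ρ n h.top k)))
    rw [mul_assoc, ← mul_assoc (cable h.top k), ← this]
    simp only [mul_assoc]
  · funext i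
    have := predAbove_perm_split h k i
    simp only [perm, split, mk, twist] at this
    simp only [split, mk, Wreath.mul_base, twist, toAdd_mul, perm, ofAdd_add, this]

theorem split_inv {n : ℕ} (g : RibbonBraid n) (k : Fin n) :
    (g⁻¹).split (g.perm k) = (g.split k)⁻¹ := by
  rw [eq_inv_iff_mul_eq_one, ← split_mul, inv_mul_cancel, split_one]

theorem split_split {n : ℕ} (g : RibbonBraid n) {k l : Fin n} (hkl : k < l) :
    (g.split l).split k.castSucc = (g.split k).split l.succ := by
  have hkl' : (k : ℕ) < l := hkl
  have e3 := predAbove_castSucc_of_lt hkl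
  have e4 := predAbove_succ_of_lt hkl
  apply Wreath.ext
  · have c : Commute (s (n + 2) k) (s (n + 2) (l + 1)) := s_comm (by omega)
    simp only [split, mk, twist, toAdd_ofAdd, Fin.val_castSucc, Fin.val_succ, e3, e4]
    rw [cable_mul, cable_mul, ρ_s_zpow_of_ne _ _ _ (by simp; omega) (by simp; omega),
      ρ_s_zpow_of_ne _ _ _ (by simp; omega) (by simp; omega),
      cable_s_zpow l _ k.castSucc (l + 1) (Or.inl ⟨by simpa using hkl', rfl⟩),
      cable_s_zpow k _ l.succ k (Or.inr ⟨by simpa using hkl', rfl⟩),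
      cable_cable _ _ _ hkl, mul_assoc, mul_assoc, (c.zpow_zpow _ _).eq]
  · funext i
    simp only [split, mk, twist, toAdd_ofAdd]
    congr 2
    refine congrArg g.base (Fin.ext ?_)
    simp only [predAbove_val, Fin.val_castSucc, Fin.val_succ]
    split_ifs <;> omega

/-- The position of the other ribbon after splitting. -/
theorem perm_split_of_lt {n : ℕ} (g : RibbonBraid n) {k l : Fin n} (hkl : k < l) :
    (g.perm k < g.perm l ∧ ((g.split k).perm l.succ : ℕ) = g.perm l + 1 ∧
      ((g.split l).perm k.castSucc : ℕ) = g.perm k) ∨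
    (g.perm l < g.perm k ∧ ((g.split k).perm l.succ : ℕ) = g.perm l ∧
      ((g.split l).perm k.castSucc : ℕ) = g.perm k + 1) := by
  have hkl' : (k : ℕ) < l := hkl
  have e3 := predAbove_castSucc_of_lt hkl
  have e4 := predAbove_succ_of_lt hkl
  have e1 := congrArg Fin.val (predAbove_perm_split g l k.castSucc)
  have e2 := congrArg Fin.val (predAbove_perm_split g k l.succ)
  rw [e3, predAbove_val] at e1
  rw [e4, predAbove_val] at e2
  have hne : g.perm k ≠ g.perm l := fun h => hkl.ne (g.perm.injective h)
  rcases lt_or_gt_of_ne hne with h | h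
  · left
    refine ⟨h, ?_, ?_⟩
    · split_ifs at e2 <;> omega
    · split_ifs at e1 <;> omega
  · right
    refine ⟨h, ?_, ?_⟩
    · split_ifs at e2 <;> omega
    · split_ifs at e1 <;> omega

end RibbonBraid

/-! ### Trees -/

/-- Finite rooted planar binary trees. -/
inductive PTree : Type
  | leaf : PTree
  | caret (l r : PTree) : PTree

namespace PTree

/-- The number of leaves. -/
def leaves : PTree → ℕ
  | leaf => 1
  | caret l r => l.leaves + r.leaves

/-- The tree obtained by adding a caret to the leaf at position `k`, where the leaves are counted
from left to right, starting from `0`. (If `k` is too large, the last leaf is used.) -/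
def addCaret : PTree → ℕ → PTree
  | leaf, _ => caret leaf leaf
  | caret l r, k =>
    if k < l.leaves then caret (l.addCaret k) r else caret l (r.addCaret (k - l.leaves))

theorem leaves_addCaret (T : PTree) : ∀ k, (T.addCaret k).leaves = T.leaves + 1 := by
  induction T with
  | leaf => intro k; rfl
  | caret l r hl hr =>
    intro k
    simp only [addCaret]
    split_ifs <;> simp only [leaves, hl, hr] <;> omega

theorem leaves_pos (T : PTree) : 0 < T.leaves := by
  induction T with
  | leaf => exact Nat.one_pos
  | caret l r hl hr => simp only [leaves]; omega

theorem addCaret_comm (T : PTree) : ∀ {p q : ℕ}, p < q → q < T.leaves →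
    (T.addCaret p).addCaret (q + 1) = (T.addCaret q).addCaret p := by
  induction T with
  | leaf => intro p q h1 h2; simp only [leaves] at h2; omega
  | caret l r hl hr =>
    intro p q h1 h2
    simp only [leaves] at h2
    by_cases hp : p < l.leaves
    · by_cases hq : q < l.leaves
      · simp only [addCaret, if_pos hp, if_pos hq, leaves_addCaret]
        rw [if_pos (by omega), if_pos (by omega), hl h1 hq]
      · simp only [addCaret, if_pos hp, if_neg hq, leaves_addCaret]
        rw [if_neg (by omega), Nat.add_sub_add_right]
    · have hq : ¬ q < l.leaves := by omega
      simp only [addCaret, if_neg hp, if_neg hq]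
      rw [if_neg (by omega), show q + 1 - l.leaves = q - l.leaves + 1 by omega,
        hr (by omega) (by omega)]

/-- `T.le W` says that `W` is obtained from `T` by adding carets. -/
def le : PTree → PTree → Prop
  | leaf, _ => True
  | caret _ _, leaf => False
  | caret a b, caret c d => a.le c ∧ b.le d

/-- The union of two trees. -/
def sup : PTree → PTree → PTree
  | leaf, W => W
  | caret a b, leaf => caret a b
  | caret a b, caret c d => caret (a.sup c) (b.sup d)

theorem le_refl (T : PTree) : T.le T := by
  induction T with
  | leaf => trivial
  | caret a b ha hb => exact ⟨ha, hb⟩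

theorem le_sup_left (T : PTree) : ∀ W : PTree, T.le (T.sup W) := by
  induction T with
  | leaf => intro W; trivial
  | caret a b ha hb =>
    intro W
    cases W with
    | leaf => exact le_refl _
    | caret c d => exact ⟨ha c, hb d⟩

theorem le_sup_right (T : PTree) : ∀ W : PTree, W.le (T.sup W) := by
  induction T with
  | leaf => intro W; exact le_refl _
  | caret a b ha hb =>
    intro W
    cases W with
    | leaf => trivial
    | caret c d => exact ⟨ha c, hb d⟩

theorem leaves_le {T : PTree} : ∀ {W : PTree}, T.le W → T.leaves ≤ W.leaves := by
  induction T with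
  | leaf => intro W _; exact leaves_pos W
  | caret a b ha hb =>
    intro W h
    cases W with
    | leaf => exact h.elim
    | caret c d => exact Nat.add_le_add (ha h.1) (hb h.2)

theorem le_trans {T : PTree} : ∀ {U W : PTree}, T.le U → U.le W → T.le W := by
  induction T with
  | leaf => intros; trivial
  | caret a b ha hb =>
    intro U W h1 h2
    cases U with
    | leaf => exact h1.elim
    | caret c d =>
      cases W with
      | leaf => exact h2.elim
      | caret e f => exact ⟨ha h1.1 h2.1, hb h1.2 h2.2⟩

theorem le_addCaret (T : PTree) : ∀ k, T.le (T.addCaret k) := by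
  induction T with
  | leaf => intros; trivial
  | caret a b ha hb =>
    intro k
    simp only [addCaret]
    split_ifs
    · exact ⟨ha _, le_refl _⟩
    · exact ⟨le_refl _, hb _⟩

theorem exists_addCaret_le {T : PTree} : ∀ {W : PTree}, T.le W → T ≠ W →
    ∃ k < T.leaves, (T.addCaret k).le W := by
  induction T with
  | leaf =>
    intro W _ hne
    cases W with
    | leaf => exact absurd rfl hne
    | caret c d => exact ⟨0, Nat.one_pos, trivial, trivial⟩
  | caret a b ha hb =>
    intro W h hne
    cases W with
    | leaf => exact h.elim
    | caret c d =>
      by_cases hac : a = c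
      · subst hac
        have hbd : b ≠ d := fun h => hne (by rw [h])
        obtain ⟨k, hk, hk'⟩ := hb h.2 hbd
        refine ⟨a.leaves + k, by simp only [leaves]; omega, ?_⟩
        rw [addCaret, if_neg (by omega), Nat.add_sub_cancel_left]
        exact ⟨h.1, hk'⟩
      · obtain ⟨k, hk, hk'⟩ := ha h.1 hac
        refine ⟨k, by simp only [leaves]; omega, ?_⟩
        rw [addCaret, if_pos hk]
        exact ⟨hk', h.2⟩

theorem addCaret_addCaret_le {T : PTree} : ∀ {W : PTree} {k l : ℕ}, k < l → l < T.leaves →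
    (T.addCaret k).le W → (T.addCaret l).le W → ((T.addCaret k).addCaret (l + 1)).le W := by
  induction T with
  | leaf => intro W k l h1 h2; simp only [leaves] at h2; omega
  | caret a b ha hb =>
    intro W k l h1 h2 hk hl
    simp only [leaves] at h2
    cases W with
    | leaf => simp only [addCaret] at hk; split_ifs at hk <;> exact hk.elim
    | caret c d =>
      by_cases hka : k < a.leaves
      · by_cases hla : l < a.leaves
        · simp only [addCaret, if_pos hka, if_pos hla, leaves_addCaret] at hk hl ⊢
          rw [if_pos (by omega)]
          exact ⟨ha h1 hla hk.1 hl.1, hk.2⟩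
        · simp only [addCaret, if_pos hka, if_neg hla, leaves_addCaret] at hk hl ⊢
          rw [if_neg (by omega), Nat.add_sub_add_right]
          exact ⟨hk.1, hl.2⟩
      · have hla : ¬ l < a.leaves := by omega
        simp only [addCaret, if_neg hka, if_neg hla] at hk hl ⊢
        rw [if_neg (by omega), show l + 1 - a.leaves = l - a.leaves + 1 by omega]
        exact ⟨hk.1, hb (by omega) (by omega) hk.2 hl.2⟩

end PTree

/-! ### Representative triples -/

/-- A representative triple `(T_-, β(m_1, …, m_n), T_+)`: two trees with `n` leaves and a ribbon
braid on `n` ribbons. -/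
structure Triple where
  n : ℕ
  left : PTree
  elt : RibbonBraid n
  right : PTree
  leaves_left : left.leaves = n
  leaves_right : right.leaves = n

namespace Triple

theorem mk_congr {n : ℕ} {L L' R R' : PTree} {g g' : RibbonBraid n} {h1 h2 h3 h4}
    (hL : L = L') (hg : g = g') (hR : R = R') :
    (⟨n, L, g, R, h1, h2⟩ : Triple) = ⟨n, L', g', R', h3, h4⟩ := by
  subst hL hg hR; rfl

/-- The `k`-th expansion of a triple: a caret is added to the `k`-th leaf of the right tree and to
the `ρ(β)(k)`-th leaf of the left tree, and the `k`-th ribbon is split. -/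
def expand (t : Triple) (k : Fin t.n) : Triple where
  n := t.n + 1
  left := t.left.addCaret (t.elt.perm k)
  elt := t.elt.split k
  right := t.right.addCaret k
  leaves_left := by rw [PTree.leaves_addCaret, t.leaves_left]
  leaves_right := by rw [PTree.leaves_addCaret, t.leaves_right]

/-- `Expands a b` says that `b` is an expansion of `a`. -/
def Expands (a b : Triple) : Prop := ∃ k, b = a.expand k

/-- The equivalence relation on triples generated by expansion. -/
instance setoid : Setoid Triple := Relation.EqvGen.setoid Expands

/-- `Comp a b c` says that, for some trees `T`, `U`, `W`, the triples `a`, `b` and `c` have the form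
`(T, g, U)`, `(U, h, W)` and `(T, g h, W)`. -/
inductive Comp : Triple → Triple → Triple → Prop
  | mk {n : ℕ} (T U W : PTree) (hT : T.leaves = n) (hU : U.leaves = n) (hW : W.leaves = n)
      (g h : RibbonBraid n) :
      Comp ⟨n, T, g, U, hT, hU⟩ ⟨n, U, h, W, hU, hW⟩ ⟨n, T, g * h, W, hT, hW⟩

/-- The triple `(T_+, g⁻¹, T_-)`. -/
def inv (t : Triple) : Triple where
  n := t.n
  left := t.right
  elt := t.elt⁻¹
  right := t.left
  leaves_left := t.leaves_right
  leaves_right := t.leaves_left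

/-- The triple `(T, 1, T)`. -/
def idTriple (T : PTree) : Triple := ⟨T.leaves, T, 1, T, rfl, rfl⟩

theorem inv_inv (t : Triple) : t.inv.inv = t := by
  cases t; exact mk_congr rfl (_root_.inv_inv _) rfl

open Relation

theorem expand_expand (t : Triple) {k l : Fin t.n} (h : k < l) :
    (t.expand l).expand k.castSucc = (t.expand k).expand l.succ := by
  have h' : (k : ℕ) < l := h
  refine mk_congr ?_ (RibbonBraid.split_split _ h) ?_
  · change (t.left.addCaret (t.elt.perm l)).addCaret ((t.elt.split l).perm k.castSucc) =
      (t.left.addCaret (t.elt.perm k)).addCaret ((t.elt.split k).perm l.succ)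
    rcases RibbonBraid.perm_split_of_lt t.elt h with ⟨h1, h2, h3⟩ | ⟨h1, h2, h3⟩
    · rw [h2, h3, PTree.addCaret_comm _ h1 (by rw [t.leaves_left]; omega)]
    · rw [h2, h3, PTree.addCaret_comm _ h1 (by rw [t.leaves_left]; omega)]
  · change (t.right.addCaret l).addCaret k = (t.right.addCaret k).addCaret (l + 1)
    rw [PTree.addCaret_comm _ h' (by rw [t.leaves_right]; omega)]

theorem inv_expand (t : Triple) (k : Fin t.n) :
    (t.expand k).inv = t.inv.expand (t.elt.perm k) := by
  refine mk_congr ?_ (RibbonBraid.split_inv _ _).symm rfl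
  change t.right.addCaret k = t.right.addCaret (ρ t.n t.elt.top⁻¹ (ρ t.n t.elt.top k))
  rw [map_inv, perm_inv_apply]

theorem Expands.inv {a b : Triple} (h : Expands a b) : Expands a.inv b.inv := by
  obtain ⟨k, rfl⟩ := h
  exact ⟨_, inv_expand a k⟩

theorem diamond {a b c : Triple} (h1 : Expands a b) (h2 : Expands a c) :
    b = c ∨ ∃ d, Expands b d ∧ Expands c d := by
  obtain ⟨k, rfl⟩ := h1
  obtain ⟨l, rfl⟩ := h2
  rcases lt_trichotomy k l with h | h | h
  · exact Or.inr ⟨_, ⟨_, rfl⟩, ⟨_, (expand_expand a h).symm⟩⟩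
  · exact Or.inl (by rw [h])
  · exact Or.inr ⟨_, ⟨_, (expand_expand a h).symm⟩, ⟨_, rfl⟩⟩

/-- Iterated expansion. -/
def Exps : Triple → Triple → Prop := ReflTransGen Expands

theorem Exps.inv {a b : Triple} (h : Exps a b) : Exps a.inv b.inv := by
  induction h with
  | refl => exact ReflTransGen.refl
  | tail _ h ih => exact ih.tail h.inv

theorem Exps.equiv {a b : Triple} (h : Exps a b) : a ≈ b := by
  induction h with
  | refl => exact Setoid.refl _
  | tail _ h ih => exact Setoid.trans ih (EqvGen.rel _ _ h)

theorem equiv_iff {a b : Triple} : a ≈ b ↔ ∃ c, Exps a c ∧ Exps b c := by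
  have he : Equivalence (Join (ReflTransGen Expands)) := by
    apply equivalence_join_reflTransGen
    intro a b c h1 h2
    rcases diamond h1 h2 with rfl | ⟨d, h3, h4⟩
    · exact ⟨b, ReflGen.refl, ReflTransGen.refl⟩
    · exact ⟨d, ReflGen.single h3, ReflTransGen.single h4⟩
  constructor
  · intro h
    induction h with
    | rel a b h => exact ⟨b, ReflTransGen.single h, ReflTransGen.refl⟩
    | refl a => exact ⟨a, ReflTransGen.refl, ReflTransGen.refl⟩
    | symm a b _ ih => exact he.symm ih
    | trans a b c _ _ ih1 ih2 => exact he.trans ih1 ih2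
  · rintro ⟨c, h1, h2⟩
    exact Setoid.trans h1.equiv (Setoid.symm h2.equiv)

theorem equiv_inv {a b : Triple} (h : a ≈ b) : a.inv ≈ b.inv := by
  obtain ⟨c, h1, h2⟩ := equiv_iff.1 h
  exact equiv_iff.2 ⟨c.inv, h1.inv, h2.inv⟩

theorem exists_exps_right (W : PTree) : ∀ (m : ℕ) (a : Triple), W.leaves - a.n = m →
    a.right.le W → ∃ b, Exps a b ∧ b.right = W := by
  intro m
  induction m with
  | zero =>
    intro a hm h
    by_cases hne : a.right = W
    · exact ⟨a, ReflTransGen.refl, hne⟩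
    · obtain ⟨k, hk, hk'⟩ := PTree.exists_addCaret_le h hne
      have := PTree.leaves_le hk'
      rw [PTree.leaves_addCaret, a.leaves_right] at this
      omega
  | succ m ih =>
    intro a hm h
    by_cases hne : a.right = W
    · exact ⟨a, ReflTransGen.refl, hne⟩
    · obtain ⟨k, hk, hk'⟩ := PTree.exists_addCaret_le h hne
      rw [a.leaves_right] at hk
      obtain ⟨b, hb, hb'⟩ := ih (a.expand ⟨k, hk⟩) (by
        change W.leaves - (a.n + 1) = m
        omega) hk'
      exact ⟨b, ReflTransGen.head ⟨_, rfl⟩ hb, hb'⟩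

theorem exps_right {a : Triple} {W : PTree} (h : a.right.le W) : ∃ b, Exps a b ∧ b.right = W :=
  exists_exps_right W _ a rfl h

theorem exps_left {a : Triple} {W : PTree} (h : a.left.le W) : ∃ b, Exps a b ∧ b.left = W := by
  obtain ⟨b, hb, hb'⟩ := exps_right (a := a.inv) h
  exact ⟨b.inv, by simpa only [inv_inv] using hb.inv, hb'⟩

theorem Exps.right_le {a b : Triple} (h : Exps a b) : a.right.le b.right := by
  induction h with
  | refl => exact PTree.le_refl _
  | tail _ h ih =>
    obtain ⟨k, rfl⟩ := h
    exact PTree.le_trans ih (PTree.le_addCaret _ _)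

theorem exps_unique_aux : ∀ (m : ℕ) (a b c : Triple), b.right.leaves - a.n = m → Exps a b →
    Exps a c → b.right = c.right → b = c := by
  intro m
  induction m using Nat.strong_induction_on with
  | _ m ih =>
    intro a b c hm hb hc hbc
    have hlt : ∀ a' : Triple, Expands a a' → Exps a' b → b.right.leaves - a'.n < m := by
      rintro a' ⟨k, rfl⟩ h
      have := PTree.leaves_le h.right_le
      rw [(a.expand k).leaves_right] at this
      change b.right.leaves - (a.n + 1) < m
      change a.n + 1 ≤ b.right.leaves at this
      omega
    have key : ∀ b' : Triple, Exps a b' → ∀ t : Triple, a = b' → Exps a t →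
        t.right = b'.right → t = b' := by
      rintro b' - t rfl ht hr
      rcases ReflTransGen.cases_head ht with h | ⟨d, ⟨k, rfl⟩, hd'⟩
      · exact h.symm
      · exfalso
        have := PTree.leaves_le (Exps.right_le hd')
        rw [hr, (a.expand k).leaves_right, a.leaves_right] at this
        change a.n + 1 ≤ a.n at this
        omega
    rcases ReflTransGen.cases_head hb with h | ⟨b1, hb1, hb2⟩
    · exact (key b hb c h hc hbc.symm).symm
    rcases ReflTransGen.cases_head hc with h | ⟨c1, hc1, hc2⟩
    · exact key c hc b h hb hbc
    have aux : ∀ (b c : Triple) (k l : Fin a.n), k < l → Exps (a.expand k) b →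
        Exps (a.expand l) c → b.right = c.right → b.right.leaves - (a.n + 1) < m → b = c := by
      intro b c k l hkl hb hc hbc hm
      have h1 := hb.right_le
      have h2 := hc.right_le
      rw [← hbc] at h2
      have h3 : ((a.expand k).expand l.succ).right.le b.right :=
        PTree.addCaret_addCaret_le (T := a.right) (k := k) (l := l) hkl
          (by rw [a.leaves_right]; exact l.2) h1 h2
      obtain ⟨d, hd, hd'⟩ := exps_right h3
      have e1 : d = b := ih _ (by rw [hd']; exact hm) (a.expand k) d b rfl
        (ReflTransGen.head ⟨_, rfl⟩ hd) hb hd'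
      have e2 : d = c := ih _ (by rw [hd']; exact hm) (a.expand l) d c rfl
        (ReflTransGen.head ⟨_, (expand_expand a hkl).symm⟩ hd) hc (hd'.trans hbc)
      exact e1.symm.trans e2
    have hm1 := hlt b1 hb1 hb2
    obtain ⟨k, rfl⟩ := hb1
    obtain ⟨l, rfl⟩ := hc1
    rcases lt_trichotomy k l with h | h | h
    · exact aux b c k l h hb2 hc2 hbc hm1
    · subst h
      exact ih _ hm1 _ b c rfl hb2 hc2 hbc
    · exact (aux c b l k h hc2 hb2 hbc.symm (by rw [← hbc]; exact hm1)).symm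

/-- An iterated expansion is determined by its right tree. -/
theorem exps_unique {a b c : Triple} (hb : Exps a b) (hc : Exps a c) (h : b.right = c.right) :
    b = c := exps_unique_aux _ a b c rfl hb hc h

/-! ### The product of triples -/

theorem exists_comp (a b : Triple) (h : a.right = b.left) : ∃ c, Comp a b c := by
  obtain ⟨n, L, g, R, h1, h2⟩ := a
  obtain ⟨m, L', g', R', h3, h4⟩ := b
  simp only at h
  subst h
  obtain rfl : n = m := h2.symm.trans h3
  exact ⟨_, Comp.mk _ _ _ _ _ _ _ _⟩

theorem Comp.unique {a b c c' : Triple} (h : Comp a b c) (h' : Comp a b c') : c = c' := by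
  cases h; cases h'; rfl

theorem Comp.right_eq_left {a b c : Triple} (h : Comp a b c) : a.right = b.left := by
  cases h; rfl

theorem Comp.inv {a b c : Triple} (h : Comp a b c) : Comp b.inv a.inv c.inv := by
  cases h with
  | mk T U W hT hU hW g h =>
    have := Comp.mk W U T hW hU hT h⁻¹ g⁻¹
    rw [← mul_inv_rev] at this
    exact this

theorem Comp.expand {n : ℕ} (T U W : PTree) (hT : T.leaves = n) (hU : U.leaves = n)
    (hW : W.leaves = n) (g h : RibbonBraid n) (k : Fin n) :
    Comp ((⟨n, T, g, U, hT, hU⟩ : Triple).expand (h.perm k))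
      ((⟨n, U, h, W, hU, hW⟩ : Triple).expand k)
      ((⟨n, T, g * h, W, hT, hW⟩ : Triple).expand k) := by
  have := Comp.mk (T.addCaret (g.perm (h.perm k))) (U.addCaret (h.perm k)) (W.addCaret k)
    (by rw [PTree.leaves_addCaret, hT]) (by rw [PTree.leaves_addCaret, hU])
    (by rw [PTree.leaves_addCaret, hW]) (g.split (h.perm k)) (h.split k)
  have e : (⟨n, T, g * h, W, hT, hW⟩ : Triple).expand k =
      ⟨n + 1, T.addCaret (g.perm (h.perm k)), g.split (h.perm k) * h.split k, W.addCaret k,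
        by rw [PTree.leaves_addCaret, hT], by rw [PTree.leaves_addCaret, hW]⟩ := by
    refine mk_congr ?_ (RibbonBraid.split_mul _ _ _) rfl
    change T.addCaret (ρ n (g.top * h.top) k) = T.addCaret (ρ n g.top (ρ n h.top k))
    rw [map_mul, Equiv.Perm.mul_apply]
  rw [e]
  exact this

theorem Comp.exps_right {a b c b' : Triple} (h : Comp a b c) (hb : Exps b b') :
    ∃ a' c', Exps a a' ∧ Exps c c' ∧ Comp a' b' c' := by
  induction hb with
  | refl => exact ⟨a, c, ReflTransGen.refl, ReflTransGen.refl, h⟩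
  | tail _ hb ih =>
    obtain ⟨a', c', ha, hc, h'⟩ := ih
    obtain ⟨k, rfl⟩ := hb
    cases h' with
    | mk T U W hT hU hW g h =>
      exact ⟨_, _, ha.tail ⟨_, rfl⟩, hc.tail ⟨_, rfl⟩, Comp.expand T U W hT hU hW g h k⟩

theorem Comp.exps_left {a b c a' : Triple} (h : Comp a b c) (ha : Exps a a') :
    ∃ b' c', Exps b b' ∧ Exps c c' ∧ Comp a' b' c' := by
  obtain ⟨x, y, h1, h2, h3⟩ := h.inv.exps_right ha.inv
  refine ⟨x.inv, y.inv, ?_, ?_, ?_⟩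
  · simpa only [inv_inv] using Exps.inv h1
  · simpa only [inv_inv] using Exps.inv h2
  · simpa only [inv_inv] using h3.inv

theorem Comp.exps_prod {a b c c' : Triple} (h : Comp a b c) (hc : Exps c c') :
    ∃ a' b', Exps a a' ∧ Exps b b' ∧ Comp a' b' c' := by
  induction hc with
  | refl => exact ⟨a, b, ReflTransGen.refl, ReflTransGen.refl, h⟩
  | tail _ hb ih =>
    obtain ⟨a', b', ha, hc, h'⟩ := ih
    obtain ⟨k, rfl⟩ := hb
    cases h' with
    | mk T U W hT hU hW g h =>
      exact ⟨_, _, ha.tail ⟨_, rfl⟩, hc.tail ⟨_, rfl⟩, Comp.expand T U W hT hU hW g h k⟩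

theorem Comp.equiv {a b c a' b' c' : Triple} (h : Comp a b c) (h' : Comp a' b' c') (ha : a ≈ a')
    (hb : b ≈ b') : c ≈ c' := by
  obtain ⟨a0, ha0, ha0'⟩ := equiv_iff.1 ha
  obtain ⟨b1, c1, hb1, hc1, h1⟩ := h.exps_left ha0
  obtain ⟨b2, c2, hb2, hc2, h2⟩ := h'.exps_left ha0'
  have hbb : b1 ≈ b2 := Setoid.trans (Setoid.symm hb1.equiv) (Setoid.trans hb hb2.equiv)
  obtain ⟨b3, hb3, hb3'⟩ := equiv_iff.1 hbb
  obtain ⟨a4, c4, ha4, hc4, h4⟩ := h1.exps_right hb3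
  obtain ⟨a5, c5, ha5, hc5, h5⟩ := h2.exps_right hb3'
  obtain rfl : a4 = a5 := exps_unique ha4 ha5 (h4.right_eq_left.trans h5.right_eq_left.symm)
  obtain rfl := h4.unique h5
  exact equiv_iff.2 ⟨c4, ReflTransGen.trans hc1 hc4, ReflTransGen.trans hc2 hc5⟩

theorem idTriple_expand (T : PTree) (k : Fin T.leaves) :
    (idTriple T).expand k = idTriple (T.addCaret k) := by
  have : ∀ (U : PTree) (m : ℕ) (h : U.leaves = m),
      (⟨m, U, 1, U, h, h⟩ : Triple) = idTriple U := by
    rintro U m rfl; rfl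
  rw [← this (T.addCaret k) (T.leaves + 1) (PTree.leaves_addCaret _ _)]
  refine mk_congr ?_ (RibbonBraid.split_one _) rfl
  change T.addCaret (ρ T.leaves 1 k) = T.addCaret k
  rw [map_one, Equiv.Perm.one_apply]

theorem idTriple_equiv (T : PTree) : idTriple PTree.leaf ≈ idTriple T := by
  obtain ⟨b, hb, hb'⟩ := Triple.exps_right (a := idTriple PTree.leaf) (W := T) trivial
  have : ∀ b, Exps (idTriple PTree.leaf) b → b = idTriple b.right := by
    intro b hb
    induction hb with
    | refl => rfl
    | tail _ h ih =>
      obtain ⟨k, rfl⟩ := h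
      revert k
      rw [ih]
      intro k
      have := idTriple_expand _ k
      rw [this]
      rfl
  rw [this b hb, hb'] at hb
  exact hb.equiv

end Triple

/-! ### The group `rV` -/

/-- The ribbon braided Thompson group `rV`, whose elements are the equivalence classes
`[T_-, β(m_1, …, m_n), T_+]` of representative triples. -/
def RV : Type := Quotient Triple.setoid

namespace RV

open Triple

/-- The class `[T_-, β(m_1, …, m_n), T_+]`. -/
def ofTriple (t : Triple) : RV := Quotient.mk _ t

/-- `MulRel x y z` says that there are representatives of `x`, `y` and `z` of the form
`(T, g, U)`, `(U, h, W)` and `(T, g h, W)`. -/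
def MulRel (x y z : RV) : Prop :=
  ∃ a b c, x = ofTriple a ∧ y = ofTriple b ∧ z = ofTriple c ∧ Comp a b c

theorem exists_rep_matching (x : RV) (b : Triple) :
    ∃ a b' : Triple, x = ofTriple a ∧ Exps b b' ∧ a.right = b'.left := by
  induction x using Quotient.ind with
  | _ a =>
    obtain ⟨a1, h1, h1'⟩ := Triple.exps_right (PTree.le_sup_left a.right b.left)
    obtain ⟨b1, h2, h2'⟩ := Triple.exps_left (PTree.le_sup_right a.right b.left)
    exact ⟨a1, b1, Quotient.sound h1.equiv, h2, h1'.trans h2'.symm⟩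

theorem existsUnique_mul (x y : RV) : ∃! z, MulRel x y z := by
  induction y using Quotient.ind with
  | _ b =>
    obtain ⟨a, b', rfl, hb, hab⟩ := exists_rep_matching x b
    obtain ⟨c, hc⟩ := exists_comp a b' hab
    refine ⟨ofTriple c, ⟨a, b', c, rfl, Quotient.sound hb.equiv, rfl, hc⟩, ?_⟩
    rintro z ⟨a2, b2, c2, h1, h2, rfl, h3⟩
    exact Quotient.sound (h3.equiv hc (Setoid.symm (Quotient.exact h1))
      (Setoid.trans (Setoid.symm (Quotient.exact h2)) hb.equiv))

/-- The product: `[T, g, U] [U, h, W] = [T, g h, W]`. -/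
noncomputable instance : Mul RV := ⟨fun x y => (existsUnique_mul x y).choose⟩

instance : One RV := ⟨ofTriple (idTriple PTree.leaf)⟩

instance : Inv RV := ⟨Quotient.map Triple.inv fun _ _ h => equiv_inv h⟩

theorem mul_eq_of_comp {a b c : Triple} (h : Comp a b c) :
    ofTriple a * ofTriple b = ofTriple c :=
  ((existsUnique_mul (ofTriple a) (ofTriple b)).choose_spec.2 _ ⟨a, b, c, rfl, rfl, rfl, h⟩).symm

/-- The formula for the product when the middle trees agree. -/
theorem mk_mul_mk {n : ℕ} (T U W : PTree) (hT : T.leaves = n) (hU : U.leaves = n)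
    (hW : W.leaves = n) (g h : RibbonBraid n) :
    ofTriple ⟨n, T, g, U, hT, hU⟩ * ofTriple ⟨n, U, h, W, hU, hW⟩ =
      ofTriple ⟨n, T, g * h, W, hT, hW⟩ :=
  mul_eq_of_comp (Comp.mk T U W hT hU hW g h)

theorem ofTriple_expand (t : Triple) (k : Fin t.n) : ofTriple (t.expand k) = ofTriple t :=
  (Quotient.sound (Relation.EqvGen.rel _ _ ⟨k, rfl⟩ : t ≈ t.expand k)).symm

theorem ofTriple_eq_of_exps {a b : Triple} (h : Exps a b) : ofTriple a = ofTriple b :=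
  Quotient.sound h.equiv

theorem one_eq (T : PTree) : (1 : RV) = ofTriple (idTriple T) := Quotient.sound (idTriple_equiv T)

protected theorem mul_assoc (x y z : RV) : x * y * z = x * (y * z) := by
  induction z using Quotient.ind with
  | _ c =>
    obtain ⟨b, c, hy, hc, hbc⟩ := exists_rep_matching y c
    subst hy
    obtain ⟨bc, hbc⟩ := exists_comp b c hbc
    obtain ⟨a, bc', hx, hbc', hm⟩ := exists_rep_matching x bc
    subst hx
    obtain ⟨b', c', hb', hc', h⟩ := hbc.exps_prod hbc'
    change ofTriple a * ofTriple b * ofTriple _ = ofTriple a * (ofTriple b * ofTriple _)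
    rw [ofTriple_eq_of_exps hc, ofTriple_eq_of_exps hc', ofTriple_eq_of_exps hb']
    cases h with
    | mk T U W hT hU hW g h =>
      obtain ⟨n, L, f, R, h1, h2⟩ := a
      simp only at hm
      subst hm
      obtain rfl := h2.symm.trans hT
      rw [mk_mul_mk, mk_mul_mk, mk_mul_mk, mk_mul_mk, mul_assoc]

noncomputable instance : Group RV :=
  Group.ofLeftAxioms RV.mul_assoc
    (by
      intro x
      induction x using Quotient.ind with
      | _ a =>
        obtain ⟨n, T, g, U, rfl, hU⟩ := a
        rw [one_eq T]
        change ofTriple _ * ofTriple _ = ofTriple _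
        rw [idTriple, mk_mul_mk, one_mul])
    (by
      intro x
      induction x using Quotient.ind with
      | _ a =>
        obtain ⟨n, T, g, U, hT, rfl⟩ := a
        rw [one_eq U]
        change ofTriple ⟨_, U, g⁻¹, T, rfl, hT⟩ * ofTriple ⟨_, T, g, U, hT, rfl⟩ = ofTriple _
        rw [mk_mul_mk, inv_mul_cancel, idTriple])

end RV

end RibbonThompson

/-! A group is perfect as soon as every homomorphism `φ` from it to a commutative group is trivial,
so it suffices to kill the values of `φ` on classes [T, g, U]. Since [T, g, T][T, 1, U] = [T, g, U]
= [T, 1, U][U, g, U], the value on [T, g, T] depends only on g (`val_self_eq`), and the problem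
splits into braids, trees and twists.

Braids. The braid relation makes all generators of `B_n` take one value σ_n. Splitting a strand away
from a crossing gives σ_n = σ_{n+1} for n ≥ 3. Splitting a strand of the crossing turns it into two
crossings and puts the new carets at neighbouring leaves of T. Write T_i for T with a caret at leaf
i. Then σ_n = φ[T_{i+1}, 1, T_i] σ_{n+1}², hence φ[T_i, 1, T_{i+1}] = σ_n for n ≥ 3. One more caret
at leaf i of both trees puts two steps between neighbouring leaves between them, so the same value
is σ_{n+1}² = σ_n². Hence σ_n = 1 (`valHom_s_zero_of_three_le`).

Trees. Moving a caret to a neighbouring leaf now costs nothing, and by induction on the number of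
leaves every [T, 1, U] has value 1 (`val_one_eq_one`). This also settles σ_2.

Twists. Once braids have value 1, a twist by a on a single ribbon has a value τ_n that does not
depend on the ribbon. Splitting the twisted ribbon gives τ_n = τ_{n+1}², splitting another one gives
τ_n = τ_{n+1}, and so the twists vanish too (`valHom_ofTwists_mulSingle_zero`). -/

namespace RibbonThompson

/-! ### Generators of the group of ribbon braids -/

namespace RibbonBraid

/-- The inclusion of braids into ribbon braids. -/
def ofBraid (n : ℕ) : Braid n →* RibbonBraid n where
  toFun β := ⟨β, 1⟩
  map_one' := rfl
  map_mul' x y := by ext <;> simp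

/-- The inclusion of the twists into ribbon braids. -/
def ofTwists (n : ℕ) : (Fin n → Multiplicative ℤ) →* RibbonBraid n where
  toFun m := ⟨1, m⟩
  map_one' := rfl
  map_mul' x y := by ext <;> simp

theorem eq_ofBraid_mul_ofTwists {n : ℕ} (g : RibbonBraid n) :
    g = ofBraid n g.top * ofTwists n g.base := by
  ext <;> simp [ofBraid, ofTwists]

/-- This shows that families of twists differing by the permutation of a braid are conjugate, so a
homomorphism to a commutative group cannot separate them. -/
theorem ofTwists_mul_ofBraid {n : ℕ} (m : Fin n → Multiplicative ℤ) (β : Braid n) :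
    ofTwists n m * ofBraid n β = ofBraid n β * ofTwists n (m ∘ ρ n β) := by
  ext <;> simp [ofBraid, ofTwists]

theorem perm_ofBraid {n : ℕ} (β : Braid n) (k : Fin n) : (ofBraid n β).perm k = ρ n β k := rfl

theorem perm_ofTwists {n : ℕ} (m : Fin n → Multiplicative ℤ) (k : Fin n) :
    (ofTwists n m).perm k = k := by
  simp [perm, ofTwists]

theorem split_ofBraid {n : ℕ} (β : Braid n) (k : Fin n) :
    (ofBraid n β).split k = ofBraid (n + 1) (cable β k) := by
  ext <;> simp [split, ofBraid, mk, twist]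

/-- The half twists of a split ribbon become crossings of its two halves; this braid factor
disappears under `φ` once braids are known to have trivial value. -/
theorem split_ofTwists {n : ℕ} (m : Fin n → Multiplicative ℤ) (k : Fin n) :
    (ofTwists n m).split k =
      ofBraid (n + 1) (s (n + 1) k ^ (m k).toAdd) * ofTwists (n + 1) (m ∘ k.predAbove) := by
  ext <;> simp [split, ofBraid, ofTwists, mk, twist, cable_one]

end RibbonBraid

/-! ### Removing a caret from a tree -/

namespace PTree

/-- Descending into a subtree that is not a leaf ends at a caret whose two children are leaves; that
caret can be removed. This drives the induction on the number of leaves. -/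
theorem exists_eq_addCaret {T : PTree} (h : T ≠ leaf) :
    ∃ U i, i < leaves U ∧ T = U.addCaret i := by
  induction T with
  | leaf => exact absurd rfl h
  | caret l r hl hr =>
    by_cases hr' : r = leaf
    · by_cases hl' : l = leaf
      · subst hl' hr'
        exact ⟨leaf, 0, Nat.one_pos, rfl⟩
      · obtain ⟨U, i, hi, rfl⟩ := hl hl'
        exact ⟨caret U r, i, by simp only [leaves]; omega, by rw [addCaret, if_pos hi]⟩
    · obtain ⟨U, i, hi, rfl⟩ := hr hr'
      exact ⟨caret l U, l.leaves + i, by simp only [leaves]; omega,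
        by rw [addCaret, if_neg (by omega), Nat.add_sub_cancel_left]⟩

end PTree

/-! ### Homomorphisms from `rV` to commutative groups -/

namespace RV

open RibbonBraid Triple

variable {A : Type*} [CommGroup A]

/-- The value of a homomorphism on `[T, g, U]`. -/
noncomputable def val (φ : RV →* A) {n : ℕ} {T U : PTree} (hT : T.leaves = n) (g : RibbonBraid n)
    (hU : U.leaves = n) : A :=
  φ (ofTriple ⟨n, T, g, U, hT, hU⟩)

variable (φ : RV →* A) {n : ℕ} {T U W : PTree}

theorem val_mul (hT : T.leaves = n) (g : RibbonBraid n) (hU : U.leaves = n) (h : RibbonBraid n)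
    (hW : W.leaves = n) : val φ hT (g * h) hW = val φ hT g hU * val φ hU h hW := by
  rw [val, ← mk_mul_mk T U W hT hU hW, map_mul, val, val]

theorem val_one (hT : T.leaves = n) : val φ hT 1 hT = 1 := by
  subst hT
  exact (congrArg φ (one_eq T)).symm.trans (map_one φ)

/-- The leaf counts are proofs about the trees, so trees are exchanged through this lemma, which
transports those proofs. -/
theorem val_congr {T' U' : PTree} {g g' : RibbonBraid n} (hT : T.leaves = n) (hU : U.leaves = n)
    (eT : T = T') (eg : g = g') (eU : U = U') :
    val φ hT g hU = val φ (eT ▸ hT) g' (eU ▸ hU) := by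
  subst eT eg eU; rfl

theorem leaves_addCaret_eq (hT : T.leaves = n) (k : ℕ) : (T.addCaret k).leaves = n + 1 := by
  rw [PTree.leaves_addCaret, hT]

theorem val_split (hT : T.leaves = n) (g : RibbonBraid n) (hU : U.leaves = n) (k : Fin n) :
    val φ hT g hU =
      val φ (leaves_addCaret_eq hT (g.perm k)) (g.split k) (leaves_addCaret_eq hU k) :=
  congrArg φ (ofTriple_expand ⟨n, T, g, U, hT, hU⟩ k).symm

theorem val_one_addCaret (hT : T.leaves = n) (hU : U.leaves = n) {k : ℕ} (hk : k < n) :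
    val φ hT 1 hU = val φ (leaves_addCaret_eq hT k) 1 (leaves_addCaret_eq hU k) := by
  rw [val_split φ hT 1 hU ⟨k, hk⟩]
  exact val_congr φ _ _ (by simp [perm]) (split_one _) rfl

/-- The value on `[T, g, T]` depends only on `g`. -/
theorem val_self_eq (hT : T.leaves = n) (hU : U.leaves = n) (g : RibbonBraid n) :
    val φ hT g hT = val φ hU g hU := by
  have h1 := val_mul φ hT g hT 1 hU
  have h2 := val_mul φ hT 1 hU g hU
  rw [mul_one] at h1
  rw [one_mul, h1, mul_comm] at h2
  exact mul_left_cancel h2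

/-- The homomorphism `g ↦ [T, g, T]`. -/
noncomputable def valHom (hT : T.leaves = n) : RibbonBraid n →* A where
  toFun g := val φ hT g hT
  map_one' := val_one φ hT
  map_mul' g h := val_mul φ hT g hT h hT

theorem valHom_apply (hT : T.leaves = n) (g : RibbonBraid n) : valHom φ hT g = val φ hT g hT :=
  rfl

theorem valHom_eq (hT : T.leaves = n) (hU : U.leaves = n) : valHom φ hT = valHom φ hU :=
  MonoidHom.ext (val_self_eq φ hT hU)

/-! ### Values on crossings -/

/-- In a commutative group the braid relation aba = bab forces a = b. -/
theorem valHom_s_succ (hT : T.leaves = n) {i : ℕ} (h : i + 2 < n) :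
    valHom φ hT (ofBraid n (s n (i + 1))) = valHom φ hT (ofBraid n (s n i)) := by
  have e := congrArg (fun β => valHom φ hT (ofBraid n β)) (s_braid h)
  simp only [map_mul] at e
  rw [mul_comm (valHom φ hT (ofBraid n (s n (i + 1)))), mul_assoc, mul_assoc] at e
  exact (mul_left_cancel (mul_left_cancel (e.trans (by rw [mul_comm (valHom φ hT _)])))).symm

theorem valHom_s (hT : T.leaves = n) {i : ℕ} (h : i + 1 < n) :
    valHom φ hT (ofBraid n (s n i)) = valHom φ hT (ofBraid n (s n 0)) := by
  induction i with
  | zero => rfl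
  | succ i ih => rw [valHom_s_succ φ hT h, ih (by omega)]

/-- Splitting a ribbon away from the crossing. -/
theorem valHom_s_addCaret (hT : T.leaves = n) (hn : 3 ≤ n) (hU : U.leaves = n + 1) :
    valHom φ hT (ofBraid n (s n 0)) = valHom φ hU (ofBraid (n + 1) (s (n + 1) 0)) := by
  -- Counted from 0, position 2 is the first one to the right of the crossing of 0 and 1; it exists
  -- because n ≥ 3.
  rw [valHom_apply, val_split φ hT _ hT ⟨2, by omega⟩]
  have e : ρ n (s n 0) ⟨2, by omega⟩ = ⟨2, by omega⟩ := by
    apply Fin.ext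
    rw [ρ_s_val (by omega)]; rfl
  rw [← valHom_eq φ (leaves_addCaret_eq hT 2) hU, valHom_apply]
  refine val_congr φ _ _ (by rw [perm_ofBraid, e]) ?_ rfl
  rw [split_ofBraid, cable_s' (by omega), cableGen_gt (by simp)]

/-- Splitting a ribbon which takes part in the crossing. -/
theorem valHom_s_eq (hT : T.leaves = n) {i : ℕ} (h : i + 1 < n) :
    valHom φ hT (ofBraid n (s n 0)) =
      val φ (leaves_addCaret_eq hT (i + 1)) 1 (leaves_addCaret_eq hT i) *
        valHom φ (leaves_addCaret_eq hT i) (ofBraid (n + 1) (s (n + 1) 0)) ^ 2 := by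
  rw [← valHom_s φ hT h, valHom_apply, val_split φ hT _ hT ⟨i, by omega⟩]
  have e : (ρ n (s n i) ⟨i, by omega⟩ : ℕ) = i + 1 := by
    rw [ρ_s_val (by omega), adjFun_self]
  -- The factor 1 allows the class to be cut into a change of trees followed by a braid on a single
  -- tree.
  have e2 : (ofBraid n (s n i)).split ⟨i, by omega⟩ =
      1 * ofBraid (n + 1) (s (n + 1) i * s (n + 1) (i + 1)) := by
    rw [split_ofBraid, cable_s' (by omega), cableGen_self, one_mul]
  rw [val_congr φ _ _ (by rw [perm_ofBraid, e]) e2 rfl,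
    val_mul φ (leaves_addCaret_eq hT (i + 1)) 1 (leaves_addCaret_eq hT i), ← valHom_apply, map_mul,
    map_mul, valHom_s φ _ (i := i) (by omega), valHom_s φ _ (i := i + 1) (by omega), pow_two]

/-! ### Moving a caret to the neighbouring leaf -/

/-- With σ_n = σ_{n+1}, the identity `valHom_s_eq` says that the inverse class has value σ_n⁻¹. -/
theorem val_one_addCaret_succ_of_three_le (hT : T.leaves = n) (hn : 3 ≤ n) {i : ℕ}
    (h : i + 1 < n) :
    val φ (leaves_addCaret_eq hT i) 1 (leaves_addCaret_eq hT (i + 1)) =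
      valHom φ hT (ofBraid n (s n 0)) := by
  have e := valHom_s_eq φ hT h
  have e1 := val_mul φ (leaves_addCaret_eq hT i) 1 (leaves_addCaret_eq hT (i + 1)) 1
    (leaves_addCaret_eq hT i)
  rw [mul_one, val_one] at e1
  rw [← valHom_s_addCaret φ hT hn, pow_two, ← mul_assoc] at e
  rw [right_eq_mul] at e
  rw [← mul_one (val φ _ _ _), ← e, ← mul_assoc, ← e1, one_mul]

/-- Both trees are expanded at leaf i. Over the common tree V = `T.addCaret i`, with n + 1 ≥ 3
leaves, they become V with a caret at i and V with a caret at i + 2, and the caret at i + 1 is an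
intermediate stop. -/
theorem val_one_addCaret_succ_eq (hT : T.leaves = n) (hn : 2 ≤ n) {i : ℕ} (h : i + 1 < n) :
    val φ (leaves_addCaret_eq hT i) 1 (leaves_addCaret_eq hT (i + 1)) =
      valHom φ (leaves_addCaret_eq hT i) (ofBraid (n + 1) (s (n + 1) 0)) ^ 2 := by
  rw [val_one_addCaret φ _ _ (k := i) (by omega),
    -- Leaf i + 1 of T is leaf i + 2 after a caret has been added at i.
    val_congr φ _ _ rfl rfl
      ((PTree.addCaret_comm T (Nat.lt_succ_self i) (by rw [hT]; exact h)).symm),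
    ← mul_one (1 : RibbonBraid _),
    val_mul φ _ 1 (leaves_addCaret_eq (leaves_addCaret_eq hT i) (i + 1)),
    val_one_addCaret_succ_of_three_le φ (leaves_addCaret_eq hT i) (by omega) (by omega),
    val_one_addCaret_succ_of_three_le φ (leaves_addCaret_eq hT i) (by omega) (by omega), pow_two]

/-- The two evaluations of the same change of trees give σ_n = σ_n². -/
theorem valHom_s_zero_of_three_le (hT : T.leaves = n) (hn : 3 ≤ n) :
    valHom φ hT (ofBraid n (s n 0)) = 1 := by
  have e := val_one_addCaret_succ_eq φ hT (by omega) (i := 0) (by omega)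
  rw [val_one_addCaret_succ_of_three_le φ hT hn (by omega), ← valHom_s_addCaret φ hT hn,
    pow_two, left_eq_mul] at e
  exact e

theorem val_one_addCaret_zero (hT : T.leaves = n) {i : ℕ} (h : i < n) :
    val φ (leaves_addCaret_eq hT 0) 1 (leaves_addCaret_eq hT i) = 1 := by
  induction i with
  | zero => exact val_one φ _
  | succ i ih =>
    rw [← mul_one (1 : RibbonBraid _), val_mul φ _ 1 (leaves_addCaret_eq hT i), ih (by omega),
      val_one_addCaret_succ_eq φ hT (by omega) h,
      -- Here n ≥ 2, so the crossing lives on n + 1 ≥ 3 strands.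
      valHom_s_zero_of_three_le φ _ (by omega), one_pow, one_mul]

/-- A homomorphism to a commutative group is trivial on Thompson's group `F`. -/
theorem val_one_eq_one (hT : T.leaves = n) (hU : U.leaves = n) : val φ hT 1 hU = 1 := by
  induction n generalizing T U with
  | zero => exact absurd hT T.leaves_pos.ne'
  | succ n ih =>
    have key : ∀ {T : PTree}, T ≠ PTree.leaf → T.leaves = n + 1 →
        ∃ (V : PTree) (i : ℕ), V.leaves = n ∧ i < n ∧ T = V.addCaret i := by
      intro T h hT
      obtain ⟨V, i, hi, rfl⟩ := PTree.exists_eq_addCaret h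
      rw [PTree.leaves_addCaret, Nat.add_right_cancel_iff] at hT
      exact ⟨V, i, hT, hT ▸ hi, rfl⟩
    by_cases hT' : T = PTree.leaf
    · have hU' : U = PTree.leaf := by
        by_contra h
        obtain ⟨V, i, hV, hi, rfl⟩ := key h hU
        subst hT'
        simp only [PTree.leaves] at hT
        omega
      subst hT' hU'
      exact val_one φ hT
    · have hU' : U ≠ PTree.leaf := by
        rintro rfl
        obtain ⟨V, i, hV, hi, rfl⟩ := key hT' hT
        simp only [PTree.leaves] at hU
        omega
      obtain ⟨V, i, hV, hi, rfl⟩ := key hT' hT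
      obtain ⟨W, j, hW, hj, rfl⟩ := key hU' hU
      -- The route from T to U first moves the caret of V to leaf 0, then replaces V by W, then
      -- moves the caret of W to leaf j. The middle class is an expansion of [V, 1, W], to which the
      -- induction hypothesis applies.
      have e := val_mul φ (leaves_addCaret_eq hV 0) 1 hT 1 (leaves_addCaret_eq hV 0)
      rw [val_one_addCaret_zero φ hV hi, one_mul, one_mul, val_one] at e
      rw [← mul_one (1 : RibbonBraid _), val_mul φ hT 1 (leaves_addCaret_eq hV 0), ← e, one_mul,
        ← mul_one (1 : RibbonBraid _),
        val_mul φ (leaves_addCaret_eq hV 0) 1 (leaves_addCaret_eq hW 0) 1 hU,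
        val_one_addCaret_zero φ hW hj, ← val_one_addCaret φ hV hW (by omega), ih, one_mul]

/-! ### Vanishing on braids -/

theorem valHom_s_zero (hT : T.leaves = n) : valHom φ hT (ofBraid n (s n 0)) = 1 := by
  by_cases hn : 1 < n
  -- One splitting passes from n ≥ 2 to at least three strands, which covers n = 2.
  · rw [valHom_s_eq φ hT hn (i := 0), val_one_eq_one, valHom_s_zero_of_three_le φ _ (by omega),
      one_pow, one_mul]
  -- With fewer than two strands, `s n 0` is the junk value 1.
  · rw [s, dif_neg (by omega), map_one, map_one]

theorem valHom_ofBraid (hT : T.leaves = n) (β : Braid n) : valHom φ hT (ofBraid n β) = 1 := by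
  induction β using Braid.induction with
  | one => rw [map_one, map_one]
  | gen i => rw [valHom_s φ hT (by omega), valHom_s_zero]
  | mul x y hx hy => rw [map_mul, map_mul, hx, hy, one_mul]
  | inv x hx => rw [map_inv, map_inv, hx, inv_one]

/-! ### Vanishing on twists -/

theorem valHom_ofTwists_comp (hT : T.leaves = n) (m : Fin n → Multiplicative ℤ) (β : Braid n) :
    valHom φ hT (ofTwists n (m ∘ ρ n β)) = valHom φ hT (ofTwists n m) := by
  have e := congrArg (valHom φ hT) (ofTwists_mul_ofBraid m β)
  rw [map_mul, map_mul, valHom_ofBraid, one_mul, mul_one] at e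
  exact e.symm

/-- A pure twist fixes all positions, so splitting ribbon k adds a caret at the same leaf on both
sides, and the crossings that arise have trivial value. -/
theorem valHom_ofTwists_comp_predAbove (hT : T.leaves = n) (hU : U.leaves = n + 1)
    (m : Fin n → Multiplicative ℤ) (k : Fin n) :
    valHom φ hU (ofTwists (n + 1) (m ∘ k.predAbove)) = valHom φ hT (ofTwists n m) := by
  rw [valHom_apply φ hT, val_split φ hT _ hT k, split_ofTwists,
    val_congr φ _ _ (by rw [perm_ofTwists]) rfl rfl, ← valHom_apply φ (leaves_addCaret_eq hT k),
    map_mul, valHom_ofBraid, one_mul, valHom_eq φ hU (leaves_addCaret_eq hT k)]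

theorem valHom_ofTwists_mulSingle (hT : T.leaves = n + 1) (a : Multiplicative ℤ)
    (k : Fin (n + 1)) :
    valHom φ hT (ofTwists (n + 1) (Pi.mulSingle k a)) =
      valHom φ hT (ofTwists (n + 1) (Pi.mulSingle 0 a)) := by
  induction k using Fin.induction with
  | zero => rfl
  | succ k ih =>
    -- The crossing of k and k + 1 carries a twist on one of these ribbons to the other.
    rw [← ih, ← valHom_ofTwists_comp φ hT _ (s (n + 1) k)]
    congr 2
    funext i
    have h : ρ (n + 1) (s (n + 1) k) i = k.succ ↔ i = k.castSucc := by
      rw [Fin.ext_iff, Fin.ext_iff, ρ_s_val (by omega), Fin.val_succ, Fin.val_castSucc, adjFun]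
      split_ifs <;> omega
    simp only [Function.comp_apply, Pi.mulSingle_apply, h]

theorem mulSingle_zero_comp_predAbove_zero (a : Multiplicative ℤ) :
    (Pi.mulSingle 0 a : Fin (n + 1) → Multiplicative ℤ) ∘ (0 : Fin (n + 1)).predAbove =
      Pi.mulSingle 0 a * Pi.mulSingle 1 a := by
  funext i
  have h : (0 : Fin (n + 1)).predAbove i = 0 ↔ i = 0 ∨ i = 1 := by
    rw [Fin.ext_iff, Fin.ext_iff, Fin.ext_iff, predAbove_val, Fin.val_zero, Fin.val_zero,
      Fin.val_one]
    split_ifs <;> omega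
  simp only [Function.comp_apply, Pi.mul_apply, Pi.mulSingle_apply, h]
  by_cases h0 : i = 0
  · simp [h0]
  · simp [h0]

/-- At least two ribbons are needed, so that the split ribbon 1 is not the twisted ribbon 0. -/
theorem mulSingle_zero_comp_predAbove_one (a : Multiplicative ℤ) :
    (Pi.mulSingle 0 a : Fin (n + 2) → Multiplicative ℤ) ∘ (1 : Fin (n + 2)).predAbove =
      Pi.mulSingle 0 a := by
  funext i
  have h : (1 : Fin (n + 2)).predAbove i = 0 ↔ i = 0 := by
    rw [Fin.ext_iff, Fin.ext_iff, predAbove_val, Fin.val_zero, Fin.val_zero, Fin.val_one]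
    split_ifs <;> omega
  simp only [Function.comp_apply, Pi.mulSingle_apply, h]

theorem valHom_ofTwists_mulSingle_zero (hT : T.leaves = n + 1) (a : Multiplicative ℤ) :
    valHom φ hT (ofTwists (n + 1) (Pi.mulSingle 0 a)) = 1 := by
  -- From two ribbons on, splitting ribbon 0 doubles the twist while splitting ribbon 1 does not: τ²
  -- = τ for the value τ on one more ribbon.
  have key : ∀ {n : ℕ} {T : PTree} (hT : T.leaves = n + 2),
      valHom φ hT (ofTwists (n + 2) (Pi.mulSingle 0 a)) = 1 := by
    intro n T hT
    have hU := leaves_addCaret_eq hT 0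
    have e0 := valHom_ofTwists_comp_predAbove φ hT hU (Pi.mulSingle 0 a) 0
    have e1 := valHom_ofTwists_comp_predAbove φ hT hU (Pi.mulSingle 0 a) 1
    rw [mulSingle_zero_comp_predAbove_zero, map_mul, map_mul,
      valHom_ofTwists_mulSingle φ hU a 1] at e0
    rw [mulSingle_zero_comp_predAbove_one] at e1
    rw [← e1] at e0
    rw [← e1]
    exact mul_eq_left.1 e0
  -- A single ribbon has no untwisted neighbour; splitting it leads to the case of at least two.
  have hU := leaves_addCaret_eq hT 0
  rw [← valHom_ofTwists_comp_predAbove φ hT hU (Pi.mulSingle 0 a) 0,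
    mulSingle_zero_comp_predAbove_zero, map_mul, map_mul, valHom_ofTwists_mulSingle φ hU a 1,
    key hU, one_mul]

theorem valHom_ofTwists (hT : T.leaves = n) (m : Fin n → Multiplicative ℤ) :
    valHom φ hT (ofTwists n m) = 1 := by
  obtain _ | n := n
  · exact absurd hT T.leaves_pos.ne'
  -- A homomorphism on a finite power is determined by its restrictions to the coordinate factors.
  have e : (valHom φ hT).comp (ofTwists (n + 1)) = 1 :=
    MonoidHom.functions_ext' _ _ _ fun k => MonoidHom.ext fun a =>
      (valHom_ofTwists_mulSingle φ hT a k).trans (valHom_ofTwists_mulSingle_zero φ hT a)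
  exact DFunLike.congr_fun e m

/-! ### Triviality of all homomorphisms to commutative groups -/

theorem hom_eq_one : φ = 1 := by
  ext x
  induction x using Quotient.ind with
  | _ t =>
    obtain ⟨n, T, g, U, hT, hU⟩ := t
    change val φ hT g hU = 1
    -- The factorization [T, g, U] = [T, g, T][T, 1, U] separates the ribbon braid from the trees.
    rw [← mul_one g, val_mul φ hT g hT, val_one_eq_one, mul_one, ← valHom_apply,
      eq_ofBraid_mul_ofTwists g, map_mul, valHom_ofBraid, valHom_ofTwists, one_mul]

end RV

end RibbonThompson

/-- The ribbon braided Thompson group `rV` is perfect. -/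
theorem corollary2p5 : Group.IsPerfect RibbonThompson.RV := by
  -- The commutator subgroup is the kernel of the map to the abelianization, and that map is
  -- trivial.
  rw [Group.isPerfect_def, ← Abelianization.ker_of, RibbonThompson.RV.hom_eq_one Abelianization.of,
    MonoidHom.ker_one]
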